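/- Let $n,m\in\mathbb{N}$, $t_f>0$, $\alpha>0$, $A\in\mathbb{R}^{n\times n}$, $B\in\mathbb{R}^{n\times m}$, let $F\subset L^2(0,t_f;\mathbb{R}^m)$ be convex and closed, and let $x_{\mathrm{ref}}\in\mathbb{R}^n$ and $u_{\mathrm{ref}}\in\mathbb{R}^m$, identified with constant functions on $(0,t_f)$, be such that $u_{\mathrm{ref}}\in F$. Denote by $P_F$ the projection in $L^2(0,t_f;\mathbb{R}^m)$ onto $F$, and let $B$ and $B^*=B^\top$ act pointwise on $L^2$ functions. Let $$\mathcal{A}: L^2(0,t_f;\mathbb{R}^n)\supset \operatorname{dom}\mathcal{A}=H^1(0,t_f;\mathbb{R}^n)\to L^2(0,t_f;\mathbb{R}^n)\times\mathbb{R}^n,\qquad \mathcal{A}x=\begin{bmatrix}\frac{\mathrm{d}}{\mathrm{d}\tau}x-Ax\\ x(0)\end{bmatrix},$$ where $\frac{\mathrm d}{\mathrm d\tau}$ is the weak derivative and $x(0)$ is the value at $0$ of the continuous representative of $x$ on $[0,t_f]$, and let $\mathcal{A}^*$ be its Hilbert space adjoint. Let $W=L^2(0,t_f;\mathbb{R}^n)\times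 L^2(0,t_f;\mathbb{R}^n)\times\mathbb{R}^n$ with the product inner product. For $x_0\in\mathbb{R}^n$ define $M_{\mathrm{opt},x_0}:W\supset\operatorname{dom}\mathcal{A}\times\operatorname{dom}\mathcal{A}^*\to W$ by $$M_{\mathrm{opt},x_0}\begin{bmatrix}x\\(\lambda,\lambda_0)\end{bmatrix}=\begin{bmatrix}x-x_{\mathrm{ref}}+\mathcal{A}^*(\lambda,\lambda_0)\\ -\mathcal{A}x+\begin{pmatrix}B\,P_F\!\left(\tfrac1\alpha B^*\lambda+u_{\mathrm{ref}}\right)\\0\end{pmatrix}+\begin{pmatrix}0\\x_0\end{pmatrix}\end{bmatrix}.$$ Then, for every $x_0\in\mathbb{R}^n$, the operator $M_{\mathrm{opt},x_0}$ is injective and maximally monotone on $W$, i.e. its graph $M\subset W\times W$ satisfies $\langle v_1-v_2,w_1-w_2\rangle_W\ge 0$ for all $(w_1,v_1),(w_2,v_2)\in M$, and no strictly larger subset of $W\times W$ has this property. -/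

import Mathlib

open MeasureTheory Set

open scoped ContDiff LinearPMap

noncomputable section

namespace OptSys

/-! ### Maximally monotone operators on a Hilbert space -/

/-- An operator `M ⊆ X × X` is monotone if `⟪v - w, x - z⟫ ≥ 0` for all `v ∈ M(x)`,
`w ∈ M(z)`. -/
def IsMonotoneOperator {X : Type*} [NormedAddCommGroup X] [InnerProductSpace ℝ X]
    (M : Set (X × X)) : Prop :=
  ∀ x z v w : X, (x, v) ∈ M → (z, w) ∈ M → 0 ≤ inner ℝ (v - w) (x - z)

/-- A monotone operator without proper monotone extension. -/
def IsMaximallyMonotone {X : Type*} [NormedAddCommGroup X] [InnerProductSpace ℝ X]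
    (M : Set (X × X)) : Prop :=
  IsMonotoneOperator M ∧ ∀ N : Set (X × X), IsMonotoneOperator N → M ⊆ N → N = M

/-- The graph in `X × X` of a single-valued operator `T : X ⊇ D → X`. -/
def operatorGraph {X : Type*} {D : Set X} (T : D → X) : Set (X × X) :=
  {p | ∃ x : D, p = ((x : X), T x)}

/-! ### Projection onto a closed convex set -/

/-- The metric projection `P_K u`: the point of `K` nearest to `u` (it exists and is unique for
`K` nonempty, closed and convex in a Hilbert space). -/
def metricProj {X : Type*} [NormedAddCommGroup X] [InnerProductSpace ℝ X]
    (K : Set X) (u : X) : X :=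
  Classical.epsilon fun v => v ∈ K ∧ ∀ w ∈ K, ‖u - v‖ ≤ ‖u - w‖

theorem metricProj_spec {X : Type*} [NormedAddCommGroup X] [InnerProductSpace ℝ X]
    [CompleteSpace X] {K : Set X} (hne : K.Nonempty) (hcl : IsClosed K) (hconv : Convex ℝ K)
    (u : X) : metricProj K u ∈ K ∧ ∀ w ∈ K, ‖u - metricProj K u‖ ≤ ‖u - w‖ := by
  refine Classical.epsilon_spec (p := fun v => v ∈ K ∧ ∀ w ∈ K, ‖u - v‖ ≤ ‖u - w‖) ?_
  obtain ⟨v, hv, h⟩ := exists_norm_eq_iInf_of_complete_convex hne hcl.isComplete hconv u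
  exact ⟨v, hv, fun w hw => h ▸ ciInf_le ⟨0, by rintro _ ⟨_, rfl⟩; positivity⟩ (⟨w, hw⟩ : K)⟩

/-! ### The space `L²(0, T; ℝᵏ)` -/

/-- `ℝᵏ` with the Euclidean norm. -/
abbrev Vec (k : ℕ) : Type := EuclideanSpace ℝ (Fin k)

/-- `L²(0, T; ℝᵏ)`. -/
abbrev L2 (T : ℝ) (k : ℕ) : Type := Lp (Vec k) 2 (volume.restrict (Ioo 0 T))

/-- The constant function with value `v`, as an element of `L²(0, T; ℝᵏ)`. -/
def constL2 (T : ℝ) {k : ℕ} (v : Vec k) : L2 T k :=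
  Lp.const 2 (volume.restrict (Ioo 0 T)) v

/-- Pointwise multiplication with a matrix, `x ↦ (t ↦ Q x(t))`, as a bounded operator
`L²(0, T; ℝˡ) → L²(0, T; ℝᵏ)`. -/
def mulL2 (T : ℝ) {k l : ℕ} (Q : Matrix (Fin k) (Fin l) ℝ) : L2 T l →L[ℝ] L2 T k :=
  ContinuousLinearMap.compLpL 2 (volume.restrict (Ioo 0 T))
    (LinearMap.toContinuousLinearMap (Matrix.toEuclideanLin Q))

/-! ### Weak derivatives and `H¹(0, T; ℝᵏ)` -/

/-- `φ ∈ C_c^∞(0, T)`. -/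
def IsTestFun (T : ℝ) (φ : ℝ → ℝ) : Prop :=
  ContDiff ℝ ∞ φ ∧ HasCompactSupport φ ∧ tsupport φ ⊆ Ioo 0 T

/-- `g` is a weak derivative of `f` on `(0, T)`. -/
def HasWeakDeriv {E : Type*} [NormedAddCommGroup E] [NormedSpace ℝ E]
    (T : ℝ) (f g : ℝ → E) : Prop :=
  ∀ φ : ℝ → ℝ, IsTestFun T φ →
    ∫ t in Ioo 0 T, deriv φ t • f t = -∫ t in Ioo 0 T, φ t • g t

/-- `c` is a continuous representative on `[0, T]` of the function `f` on `(0, T)`. -/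
def IsContRep {E : Type*} [NormedAddCommGroup E]
    (T : ℝ) (f c : ℝ → E) : Prop :=
  ContinuousOn c (Icc 0 T) ∧ f =ᵐ[volume.restrict (Ioo 0 T)] c

theorem IsTestFun.integrable {T : ℝ} {φ : ℝ → ℝ} (h : IsTestFun T φ)
    {E : Type*} [NormedAddCommGroup E] [NormedSpace ℝ E] {g : ℝ → E}
    (hg : IntegrableOn g (Ioo 0 T)) : Integrable (fun t => φ t • g t) (volume.restrict (Ioo 0 T)) := by
  obtain ⟨C, hC⟩ := h.2.1.exists_bound_of_continuous h.1.continuous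
  exact hg.bdd_smul C h.1.continuous.aestronglyMeasurable (Filter.Eventually.of_forall hC)

theorem IsTestFun.integrable_deriv {T : ℝ} {φ : ℝ → ℝ} (h : IsTestFun T φ)
    {E : Type*} [NormedAddCommGroup E] [NormedSpace ℝ E] {g : ℝ → E}
    (hg : IntegrableOn g (Ioo 0 T)) :
    Integrable (fun t => deriv φ t • g t) (volume.restrict (Ioo 0 T)) := by
  have hc : Continuous (deriv φ) := h.1.continuous_deriv (by simp)
  obtain ⟨C, hC⟩ := h.2.1.deriv.exists_bound_of_continuous hc
  exact hg.bdd_smul C hc.aestronglyMeasurable (Filter.Eventually.of_forall hC)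

theorem IsTestFun.eq_zero {T : ℝ} {φ : ℝ → ℝ} (h : IsTestFun T φ) {t : ℝ} (ht : t ∉ Ioo 0 T) :
    φ t = 0 :=
  image_eq_zero_of_notMem_tsupport fun h' => ht (h.2.2 h')

theorem IsTestFun.integral_deriv_Ioo {T : ℝ} {φ : ℝ → ℝ} (h : IsTestFun T φ) {s : ℝ}
    (hs : s ∈ Ioo 0 T) : ∫ t in Ioo 0 T, (if s < t then deriv φ t else 0) = -φ s := by
  have hc : Continuous (deriv φ) := h.1.continuous_deriv (by simp)
  have h1 : ∫ t in s..T, deriv φ t = φ T - φ s :=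
    intervalIntegral.integral_deriv_eq_sub
      (fun x _ => (h.1.differentiable (by simp)).differentiableAt)
      (hc.intervalIntegrable _ _)
  rw [h.eq_zero (t := T) (by simp), zero_sub, intervalIntegral.integral_of_le hs.2.le,
    integral_Ioc_eq_integral_Ioo] at h1
  rw [← h1]
  have h2 : (fun t => if s < t then deriv φ t else 0) = (Ioi s).indicator (deriv φ) := by
    ext t; simp [indicator]
  rw [h2, integral_indicator measurableSet_Ioi, Measure.restrict_restrict measurableSet_Ioi]
  congr 2
  ext t
  simp only [mem_inter_iff, mem_Ioi, mem_Ioo]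
  have := hs.1
  constructor
  · tauto
  · rintro ⟨a, b⟩; exact ⟨a, by linarith, b⟩

theorem hasWeakDeriv_primitive {E : Type*} [NormedAddCommGroup E] [NormedSpace ℝ E]
    [CompleteSpace E] {T : ℝ} {g : ℝ → E} (hg : IntegrableOn g (Ioo 0 T)) :
    HasWeakDeriv T (fun t => ∫ s in (0 : ℝ)..t, g s) g := by
  intro φ hφ
  set μ := volume.restrict (Ioo 0 T) with hμ
  have hc : Continuous (deriv φ) := hφ.1.continuous_deriv (by simp)
  have hint : Integrable (deriv φ) μ := by
    have := hφ.integrable_deriv (T := T) (g := fun _ => (1 : ℝ)) (by simp [IntegrableOn])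
    simpa using this
  have hF : Integrable (Function.uncurry fun t s => (if s < t then deriv φ t else 0) • g s)
      (μ.prod μ) := by
    have h1 : Integrable (fun z : ℝ × ℝ => deriv φ z.1 • g z.2) (μ.prod μ) := hint.smul_prod hg
    have hm : MeasurableSet {z : ℝ × ℝ | z.2 < z.1} := measurableSet_lt measurable_snd measurable_fst
    refine (h1.indicator hm).congr (Filter.Eventually.of_forall fun z => ?_)
    by_cases hz : z.2 < z.1 <;> simp [Function.uncurry, indicator, hz]
  calc ∫ t in Ioo 0 T, deriv φ t • ∫ s in (0 : ℝ)..t, g s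
      = ∫ t in Ioo 0 T, ∫ s in Ioo 0 T, (if s < t then deriv φ t else 0) • g s := by
        refine setIntegral_congr_fun measurableSet_Ioo fun t ht => ?_
        have h2 : (fun s => (if s < t then deriv φ t else 0) • g s)
            = (Iio t).indicator (fun s => deriv φ t • g s) := by
          ext s; by_cases hs : s < t <;> simp [indicator, hs]
        rw [h2, integral_indicator measurableSet_Iio, Measure.restrict_restrict measurableSet_Iio,
          integral_smul, intervalIntegral.integral_of_le ht.1.le, integral_Ioc_eq_integral_Ioo]
        congr 3
        ext s
        simp only [mem_inter_iff, mem_Iio, mem_Ioo]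
        have := ht.2
        constructor
        · rintro ⟨a, b⟩; exact ⟨b, a, by linarith⟩
        · tauto
    _ = ∫ s in Ioo 0 T, ∫ t in Ioo 0 T, (if s < t then deriv φ t else 0) • g s :=
        integral_integral_swap hF
    _ = ∫ s in Ioo 0 T, -(φ s • g s) := by
        refine setIntegral_congr_fun measurableSet_Ioo fun s hs => ?_
        rw [integral_smul_const, hφ.integral_deriv_Ioo hs, neg_smul]
    _ = -∫ t in Ioo 0 T, φ t • g t := integral_neg _

/-- A smooth function with compact support in `(0, T)` and vanishing integral is the derivative
of a test function. -/
theorem IsTestFun.exists_primitive {T : ℝ} {θ : ℝ → ℝ} (h : IsTestFun T θ)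
    (h0 : ∫ t, θ t = 0) : ∃ φ, IsTestFun T φ ∧ deriv φ = θ := by
  have hd : ∀ t, HasDerivAt (fun t => ∫ s in (0 : ℝ)..t, θ s) (θ t) t := fun t =>
    intervalIntegral.integral_hasDerivAt_right (h.1.continuous.intervalIntegrable _ _)
      h.1.continuous.stronglyMeasurable.stronglyMeasurableAtFilter h.1.continuous.continuousAt
  have hderiv : deriv (fun t => ∫ s in (0 : ℝ)..t, θ s) = θ := funext fun t => (hd t).deriv
  rcases (tsupport θ).eq_empty_or_nonempty with he | hne
  · have hz : θ = 0 := by simpa [tsupport_eq_empty_iff] using he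
    refine ⟨0, ⟨contDiff_const, HasCompactSupport.zero, ?_⟩, ?_⟩
    · simp [tsupport]
    · rw [hz]; ext; simp
  obtain ⟨a, ha, ha'⟩ := h.2.1.exists_isLeast hne
  obtain ⟨b, hb, hb'⟩ := h.2.1.exists_isGreatest hne
  have hθ : ∀ t, t ∉ Icc a b → θ t = 0 := fun t ht =>
    image_eq_zero_of_notMem_tsupport fun h' => ht ⟨ha' h', hb' h'⟩
  have hsub : tsupport (fun t => ∫ s in (0 : ℝ)..t, θ s) ⊆ Icc a b := by
    refine closure_minimal ?_ isClosed_Icc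
    intro t ht
    by_contra hn
    apply ht
    have hab : t < a ∨ b < t := by
      by_contra! hc; exact hn ⟨hc.1, hc.2⟩
    have ha0 := (h.2.2 ha).1
    have hbT := (h.2.2 hb).1
    rcases hab with hta | htb
    · refine intervalIntegral.integral_zero_ae (Filter.Eventually.of_forall fun s hs => ?_)
      refine hθ s fun hs' => ?_
      have : s ≤ max 0 t := hs.2
      have : max 0 t < a := max_lt ha0 hta
      linarith [hs'.1]
    · change ∫ s in (0 : ℝ)..t, θ s = 0
      rw [intervalIntegral.integral_of_le (by linarith), ← h0]
      refine setIntegral_eq_integral_of_forall_compl_eq_zero fun s hs => hθ s fun hs' => hs ?_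
      exact ⟨by linarith [hs'.1], by linarith [hs'.2]⟩
  refine ⟨_, ⟨?_, ?_, ?_⟩, hderiv⟩
  · rw [contDiff_infty_iff_deriv, hderiv]
    exact ⟨fun t => (hd t).differentiableAt, h.1⟩
  · exact isCompact_Icc.of_isClosed_subset (isClosed_tsupport _) hsub
  · exact hsub.trans fun t ht =>
      ⟨(h.2.2 ha).1.trans_le ht.1, ht.2.trans_lt (h.2.2 hb).2⟩

theorem exists_isTestFun_integral_eq_one {T : ℝ} (hT : 0 < T) :
    ∃ ψ, IsTestFun T ψ ∧ ∫ t, ψ t = 1 := by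
  let f : ContDiffBump (T / 2) := ⟨T / 8, T / 4, by positivity, by linarith⟩
  refine ⟨f.normed volume, ⟨f.contDiff_normed, f.hasCompactSupport_normed, ?_⟩,
    f.integral_normed⟩
  rw [f.tsupport_normed_eq]
  intro t ht
  rw [Real.closedBall_eq_Icc] at ht
  have h1 : T / 2 - T / 4 ≤ t := ht.1
  have h2 : t ≤ T / 2 + T / 4 := ht.2
  exact ⟨by linarith, by linarith⟩

/-- A function whose weak derivative vanishes is constant. -/
theorem ae_eq_const_of_hasWeakDeriv_zero {E : Type*} [NormedAddCommGroup E] [NormedSpace ℝ E]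
    [CompleteSpace E] {T : ℝ} (hT : 0 < T) {y : ℝ → E} (hy : IntegrableOn y (Ioo 0 T))
    (h : HasWeakDeriv T y 0) : ∃ c : E, ∀ᵐ t ∂(volume.restrict (Ioo 0 T)), y t = c := by
  obtain ⟨ψ, hψ, hψ1⟩ := exists_isTestFun_integral_eq_one hT
  refine ⟨∫ t in Ioo 0 T, ψ t • y t, ?_⟩
  set c := ∫ t in Ioo 0 T, ψ t • y t with hc
  have hcint : IntegrableOn (fun _ : ℝ => c) (Ioo 0 T) := by simp [IntegrableOn]
  have key : ∀ᵐ t, t ∈ Ioo 0 T → y t - c = 0 := by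
    refine isOpen_Ioo.ae_eq_zero_of_integral_contDiff_smul_eq_zero
      (hy.sub hcint).locallyIntegrableOn fun η hη hηc hηs => ?_
    have hηt : IsTestFun T η := ⟨hη, hηc, hηs⟩
    have hθ : IsTestFun T (fun t => η t - (∫ s, η s) * ψ t) := by
      refine ⟨hη.sub (contDiff_const.mul hψ.1), hηc.sub (hψ.2.1.mul_left), ?_⟩
      refine (tsupport_sub _ _).trans (union_subset hηs ?_)
      exact (closure_mono (Function.support_mul_subset_right _ _)).trans hψ.2.2
    have hηI : Integrable η := hη.continuous.integrable_of_hasCompactSupport hηc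
    have hψI : Integrable ψ := hψ.1.continuous.integrable_of_hasCompactSupport hψ.2.1
    obtain ⟨φ, hφ, hφd⟩ := hθ.exists_primitive (by
      rw [integral_sub hηI (hψI.const_mul _), integral_const_mul, hψ1]; ring)
    have h1 := h φ hφ
    simp only [hφd, Pi.zero_apply, smul_zero, integral_zero, neg_zero, sub_smul, mul_smul] at h1
    have hz : ∫ t in Ioo 0 T, η t = ∫ s, η s :=
      setIntegral_eq_integral_of_forall_compl_eq_zero fun t ht => hηt.eq_zero ht
    rw [integral_sub (hηt.integrable hy) ((hψ.integrable hy).fun_smul _), integral_smul, ← hc] at h1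
    have h2 : ∫ t, η t • (y t - c) = ∫ t in Ioo 0 T, η t • (y t - c) :=
      (setIntegral_eq_integral_of_forall_compl_eq_zero fun t ht => by
        rw [hηt.eq_zero ht, zero_smul]).symm
    rw [h2]
    simp only [smul_sub]
    rw [integral_sub (hηt.integrable hy) (hηt.integrable hcint), integral_smul_const, hz]
    exact h1
  rw [ae_restrict_iff' measurableSet_Ioo]
  filter_upwards [key] with t ht ht'
  exact sub_eq_zero.1 (ht ht')

theorem HasWeakDeriv.ae_unique {E : Type*} [NormedAddCommGroup E] [NormedSpace ℝ E]
    [CompleteSpace E] {T : ℝ} {f g g' : ℝ → E} (hg : IntegrableOn g (Ioo 0 T))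
    (hg' : IntegrableOn g' (Ioo 0 T)) (h : HasWeakDeriv T f g) (h' : HasWeakDeriv T f g') :
    g =ᵐ[volume.restrict (Ioo 0 T)] g' := by
  have key : ∀ᵐ t, t ∈ Ioo 0 T → g t - g' t = 0 := by
    refine isOpen_Ioo.ae_eq_zero_of_integral_contDiff_smul_eq_zero
      (hg.sub hg').locallyIntegrableOn fun η hη hηc hηs => ?_
    have hηt : IsTestFun T η := ⟨hη, hηc, hηs⟩
    have h2 : ∫ t, η t • (g t - g' t) = ∫ t in Ioo 0 T, η t • (g t - g' t) :=
      (setIntegral_eq_integral_of_forall_compl_eq_zero fun t ht => by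
        rw [hηt.eq_zero ht, zero_smul]).symm
    rw [h2]
    simp only [smul_sub]
    rw [integral_sub (hηt.integrable hg) (hηt.integrable hg'), sub_eq_zero]
    exact neg_injective ((h η hηt).symm.trans (h' η hηt))
  rw [Filter.EventuallyEq, ae_restrict_iff' measurableSet_Ioo]
  filter_upwards [key] with t ht ht'
  exact sub_eq_zero.1 (ht ht')

theorem HasWeakDeriv.exists_isContRep {E : Type*} [NormedAddCommGroup E] [NormedSpace ℝ E]
    [CompleteSpace E] {T : ℝ} (hT : 0 < T) {f g : ℝ → E} (hf : IntegrableOn f (Ioo 0 T))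
    (hg : IntegrableOn g (Ioo 0 T)) (h : HasWeakDeriv T f g) : ∃ c, IsContRep T f c := by
  have hg' : IntegrableOn g (Icc 0 T) := (integrableOn_Icc_iff_integrableOn_Ioo).2 hg
  have hG : ContinuousOn (fun t => ∫ s in (0 : ℝ)..t, g s) (Icc 0 T) :=
    intervalIntegral.continuousOn_primitive_interval (by rwa [uIcc_of_le hT.le]) |>.mono
      (by rw [uIcc_of_le hT.le])
  have hGi : IntegrableOn (fun t => ∫ s in (0 : ℝ)..t, g s) (Ioo 0 T) :=
    (hG.integrableOn_compact isCompact_Icc).mono_set Ioo_subset_Icc_self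
  obtain ⟨c, hc⟩ := ae_eq_const_of_hasWeakDeriv_zero hT (hf.sub hGi) (by
    intro φ hφ
    simp only [Pi.sub_apply, smul_sub, Pi.zero_apply, smul_zero, integral_zero, neg_zero]
    rw [integral_sub (hφ.integrable_deriv hf) (hφ.integrable_deriv hGi), h φ hφ,
      hasWeakDeriv_primitive hg φ hφ, sub_self])
  refine ⟨fun t => (∫ s in (0 : ℝ)..t, g s) + c, hG.add continuousOn_const, ?_⟩
  filter_upwards [hc] with t ht
  rw [← ht]; simp

theorem IsContRep.eqOn {E : Type*} [NormedAddCommGroup E] {T : ℝ} (hT : 0 < T)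
    {f c c' : ℝ → E} (h : IsContRep T f c) (h' : IsContRep T f c') : EqOn c c' (Icc 0 T) := by
  refine Measure.eqOn_Icc_of_ae_eq volume hT.ne ?_ h.1 h'.1
  rw [← restrict_Ioo_eq_restrict_Icc]
  exact h.2.symm.trans h'.2

theorem integrableOn_L2 {T : ℝ} {k : ℕ} (x : L2 T k) : IntegrableOn x (Ioo 0 T) :=
  (Lp.memLp x).integrable (by norm_num)

theorem HasWeakDeriv.congr {E : Type*} [NormedAddCommGroup E] [NormedSpace ℝ E] {T : ℝ}
    {f f' g g' : ℝ → E} (h : HasWeakDeriv T f g) (hf : f =ᵐ[volume.restrict (Ioo 0 T)] f')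
    (hg : g =ᵐ[volume.restrict (Ioo 0 T)] g') : HasWeakDeriv T f' g' := by
  intro φ hφ
  have h1 : ∫ t in Ioo 0 T, deriv φ t • f t = ∫ t in Ioo 0 T, deriv φ t • f' t :=
    integral_congr_ae (hf.mono fun t ht => congrArg (deriv φ t • ·) ht)
  have h2 : ∫ t in Ioo 0 T, φ t • g t = ∫ t in Ioo 0 T, φ t • g' t :=
    integral_congr_ae (hg.mono fun t ht => congrArg (φ t • ·) ht)
  rw [← h1, ← h2, h φ hφ]

theorem hasWeakDeriv_add {T : ℝ} {k : ℕ} {x y g h : L2 T k} (hx : HasWeakDeriv T x g)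
    (hy : HasWeakDeriv T y h) : HasWeakDeriv T (x + y : L2 T k) (g + h : L2 T k) := by
  refine HasWeakDeriv.congr (f := ⇑x + ⇑y) (g := ⇑g + ⇑h) (fun φ hφ => ?_)
    (Lp.coeFn_add x y).symm (Lp.coeFn_add g h).symm
  simp only [Pi.add_apply, smul_add]
  rw [integral_add (hφ.integrable_deriv (integrableOn_L2 x)) (hφ.integrable_deriv (integrableOn_L2 y)),
    integral_add (hφ.integrable (integrableOn_L2 g)) (hφ.integrable (integrableOn_L2 h)),
    hx φ hφ, hy φ hφ, neg_add]

theorem hasWeakDeriv_smul {T : ℝ} {k : ℕ} {x g : L2 T k} (r : ℝ) (hx : HasWeakDeriv T x g) :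
    HasWeakDeriv T (r • x : L2 T k) (r • g : L2 T k) := by
  refine HasWeakDeriv.congr (f := r • ⇑x) (g := r • ⇑g) (fun φ hφ => ?_)
    (Lp.coeFn_smul r x).symm (Lp.coeFn_smul r g).symm
  simp only [Pi.smul_apply, smul_comm _ r]
  rw [integral_smul, integral_smul, hx φ hφ, smul_neg]

/-- The Sobolev space `H¹(0, T; ℝᵏ)`: functions in `L²(0, T; ℝᵏ)` with weak derivative in
`L²(0, T; ℝᵏ)`. -/
def H1 (T : ℝ) (k : ℕ) : Submodule ℝ (L2 T k) where
  carrier := {x | ∃ g : L2 T k, HasWeakDeriv T x g}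
  add_mem' := fun ⟨_, hg⟩ ⟨_, hh⟩ => ⟨_, hasWeakDeriv_add hg hh⟩
  zero_mem' := ⟨0, HasWeakDeriv.congr (f := 0) (g := 0) (fun φ _ => by simp)
    (Lp.coeFn_zero _ _ _).symm (Lp.coeFn_zero _ _ _).symm⟩
  smul_mem' := fun r _ ⟨_, hg⟩ => ⟨_, hasWeakDeriv_smul r hg⟩

theorem H1.weakDeriv_unique {T : ℝ} {k : ℕ} {x g g' : L2 T k} (h : HasWeakDeriv T x g)
    (h' : HasWeakDeriv T x g') : g = g' :=
  Lp.ext (h.ae_unique (integrableOn_L2 g) (integrableOn_L2 g') h')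

/-- The weak derivative `H¹(0, T; ℝᵏ) → L²(0, T; ℝᵏ)`. -/
def weakDeriv (T : ℝ) (k : ℕ) : H1 T k →ₗ[ℝ] L2 T k where
  toFun x := x.2.choose
  map_add' x y := H1.weakDeriv_unique (x + y).2.choose_spec
    (hasWeakDeriv_add x.2.choose_spec y.2.choose_spec)
  map_smul' r x := H1.weakDeriv_unique (r • x).2.choose_spec
    (hasWeakDeriv_smul r x.2.choose_spec)

theorem H1.exists_isContRep {T : ℝ} (hT : 0 < T) {k : ℕ} (x : H1 T k) :
    ∃ c, IsContRep T (x : L2 T k) c :=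
  x.2.choose_spec.exists_isContRep hT (integrableOn_L2 _) (integrableOn_L2 _)

/-- The initial value `x(0)` of `x ∈ H¹(0, T; ℝᵏ)`, that is, the value at `0` of the continuous
representative of `x` on `[0, T]`. -/
def initialValue {T : ℝ} (hT : 0 < T) (k : ℕ) : H1 T k →ₗ[ℝ] Vec k where
  toFun x := (H1.exists_isContRep hT x).choose 0
  map_add' x y := by
    have hx := (H1.exists_isContRep hT x).choose_spec
    have hy := (H1.exists_isContRep hT y).choose_spec
    refine (H1.exists_isContRep hT (x + y)).choose_spec.eqOn hT (c' := _ + _)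
      ⟨hx.1.add hy.1, ?_⟩ (left_mem_Icc.2 hT.le)
    exact (Lp.coeFn_add (x : L2 T k) (y : L2 T k)).trans (hx.2.add hy.2)
  map_smul' r x := by
    have hx := (H1.exists_isContRep hT x).choose_spec
    refine (H1.exists_isContRep hT (r • x)).choose_spec.eqOn hT (c' := r • _)
      ⟨hx.1.const_smul r, ?_⟩ (left_mem_Icc.2 hT.le)
    exact (Lp.coeFn_smul r (x : L2 T k)).trans (hx.2.const_smul r)

/-! ### The operators of the optimality system -/

/-- `𝒜 x = (x' - A x, x(0))` as an unbounded operator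
`L²(0, T; ℝⁿ) ⊇ H¹(0, T; ℝⁿ) → L²(0, T; ℝⁿ) × ℝⁿ`. -/
def stateOp {T : ℝ} (hT : 0 < T) {n : ℕ} (A : Matrix (Fin n) (Fin n) ℝ) :
    L2 T n →ₗ.[ℝ] WithLp 2 (L2 T n × Vec n) where
  domain := H1 T n
  toFun := (WithLp.linearEquiv 2 ℝ (L2 T n × Vec n)).symm.toLinearMap ∘ₗ
    ((weakDeriv T n - (mulL2 T A).toLinearMap ∘ₗ (H1 T n).subtype).prod (initialValue hT n))

/-- The Hilbert space `W = L²(0, T; ℝⁿ) × (L²(0, T; ℝⁿ) × ℝⁿ)`, with elements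
`w = (x, (λ, λ₀))`. -/
abbrev OptSpace (T : ℝ) (n : ℕ) : Type := WithLp 2 (L2 T n × WithLp 2 (L2 T n × Vec n))

/-- `dom M_opt = dom 𝒜 × dom 𝒜*`, where `𝒜* = (stateOp hT A)†` is the Hilbert space adjoint. -/
def optDomain {T : ℝ} (hT : 0 < T) {n : ℕ} (A : Matrix (Fin n) (Fin n) ℝ) :
    Set (OptSpace T n) :=
  {w | w.fst ∈ (stateOp hT A).domain ∧ w.snd ∈ ((stateOp hT A)†).domain}

/-- The operator of the control-reduced optimality system,
`M_opt (x, (λ, λ₀)) = (x - x_ref + 𝒜*(λ, λ₀), -𝒜 x + (B P_F(α⁻¹ B* λ + u_ref), 0) + (0, x₀))`. -/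
def optOp {T : ℝ} (hT : 0 < T) {n m : ℕ} (A : Matrix (Fin n) (Fin n) ℝ)
    (B : Matrix (Fin n) (Fin m) ℝ) (α : ℝ) (F : Set (L2 T m)) (xref : Vec n) (uref : Vec m)
    (x₀ : Vec n) (w : optDomain hT A) : OptSpace T n :=
  WithLp.toLp 2
    (w.1.fst - constL2 T xref + (stateOp hT A)† ⟨w.1.snd, w.2.2⟩,
      -(stateOp hT A ⟨w.1.fst, w.2.1⟩)
        + WithLp.toLp 2
            (mulL2 T B (metricProj F (α⁻¹ • mulL2 T B.transpose w.1.snd.fst + constL2 T uref)), 0)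
        + WithLp.toLp 2 (0, x₀))

end OptSys

end

/-!
The operator of the optimality system has the form `M (x, y) = (x - a + T† y, -T x + G y)` with
`T = 𝒜`, where `G` collects the control term and the initial value. The part `(T† y, -T x)` is
skew-adjoint when `T` is closed and densely defined, and `(x - a, G y)` is defined everywhere, monotone
and Lipschitz continuous.

*Maximality.* Decomposing `H × K` orthogonally along the graph of `μ⁻¹ T` shows that `μ` plus the
skew-adjoint part is surjective for every `μ > 0` (`exists_smul_add_adjoint_eq`), and its inverse
has Lipschitz constant `μ⁻¹`. For `μ` above the Lipschitz constant of `(x - a, G y)`, Banach's fixed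
point theorem makes `μ + M` surjective (`exists_blockGraph_smul_add_eq`), and by Minty's argument a
monotone operator with this property is maximal (`isMaximallyMonotone_blockGraph`).

*Injectivity.* If `M` takes the same value at two points, the monotonicity estimate, in which the
terms with `T` and `T†` cancel, bounds the squared distance of their first components by `0`. Then
`T†` takes the same value at the second components, and `T†` is injective because the range of `T`
is dense (`blockGraph_injective`).

*The state operator.* With the Volterra operator `V g = ∫₀ᵗ g`, the relation `𝒜 x = (h, c)` is
equivalent to `x = V (h + A x) + c` (`mem_graph_stateOp_iff`), so `𝒜` is closed. Its domain contains
the vector-valued test functions and is dense (`dense_H1`); by the variation of constants formula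
its range contains all `(w, c)` with `w` continuous, hence is dense (`eq_zero_of_inner_stateOp`).

*The control term.* The metric projection is firmly nonexpansive (`sq_norm_metricProj_sub_le`). As
`B*` is the adjoint of `B`, the map `λ ↦ B P_F(α⁻¹ B* λ + u_ref)` is monotone and Lipschitz
(`inner_controlMap_sub_nonneg`, `lipschitzWith_controlMap`).
-/

namespace OptSys

/-! ### Skew-adjoint block operators with a Lipschitz perturbation -/

section BlockOperator

variable {H K : Type*} [NormedAddCommGroup H] [InnerProductSpace ℝ H] [CompleteSpace H]
  [NormedAddCommGroup K] [InnerProductSpace ℝ K]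

/-- The block operator `(x, y) ↦ (T† y, -T x)` is skew-adjoint, so adding a positive multiple of
the identity makes it surjective. This is the orthogonal decomposition of `H × K` along the graph
of `μ⁻¹ T`. -/
theorem exists_smul_add_adjoint_eq [CompleteSpace K] (T : H →ₗ.[ℝ] K)
    (hd : Dense (T.domain : Set H))
    (hc : IsClosed (T.graph : Set (H × K))) {μ : ℝ} (hμ : 0 < μ) (f : H) (g : K) :
    ∃ (x : T.domain) (y : T†.domain),
      μ • (x : H) + T† y = f ∧ μ • (y : K) - T x = g := by
  set ℓ : WithLp 2 (H × K) →L[ℝ] H × K :=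
    (WithLp.fstL 2 ℝ H K).prod (μ • WithLp.sndL 2 ℝ H K) with hℓ
  have hℓa : ∀ w, ℓ w = (w.fst, μ • w.snd) := fun w => rfl
  -- `G` is the graph of `μ⁻¹ T` as a closed subspace of the Hilbert space `H × K`.
  set G : Submodule ℝ (WithLp 2 (H × K)) := T.graph.comap ℓ.toLinearMap with hG
  have hGc : IsClosed (G : Set (WithLp 2 (H × K))) := hc.preimage ℓ.continuous
  have : CompleteSpace G := hGc.completeSpace_coe
  obtain ⟨u, hu, v, hv, huv⟩ := G.exists_add_mem_mem_orthogonal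
    (WithLp.toLp 2 (μ⁻¹ • f, -(μ⁻¹ • g)))
  have h1 : μ⁻¹ • f = u.fst + v.fst := congrArg WithLp.fst huv
  have h2 : -(μ⁻¹ • g) = u.snd + v.snd := congrArg WithLp.snd huv
  obtain ⟨x, hx1, hx2⟩ := (T.mem_graph_iff).1 (show ℓ u ∈ T.graph from hu)
  rw [hℓa] at hx1 hx2
  simp only at hx1 hx2
  -- Orthogonality of `v` to the graph says that `T†(-v.snd) = μ v.fst`.
  have hadj : ∀ z : T.domain, inner ℝ (μ • v.fst) (z : H) = inner ℝ (-v.snd) (T z) := by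
    intro z
    have hz : WithLp.toLp 2 ((z : H), μ⁻¹ • T z) ∈ G := by
      change ℓ _ ∈ T.graph
      rw [hℓa, T.mem_graph_iff]
      exact ⟨z, rfl, by simp [smul_smul, hμ.ne']⟩
    have := (Submodule.mem_orthogonal' _ _).1 hv _ hz
    rw [WithLp.prod_inner_apply] at this
    simp only [WithLp.ofLp_fst, WithLp.ofLp_snd, inner_smul_right] at this
    rw [inner_smul_left, inner_neg_left]
    simp only [conj_trivial]
    field_simp at this
    linarith
  have hy : -v.snd ∈ T†.domain := T.mem_adjoint_domain_of_exists _ ⟨_, hadj⟩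
  refine ⟨x, ⟨-v.snd, hy⟩, ?_, ?_⟩
  · rw [LinearPMap.adjoint_apply_eq hd _ hadj, hx1, ← smul_add, ← h1, smul_smul,
      mul_inv_cancel₀ hμ.ne', one_smul]
  · rw [hx2]
    change μ • (-v.snd) - μ • u.snd = g
    rw [show μ • (-v.snd) - μ • u.snd = -(μ • (u.snd + v.snd)) by module, ← h2, smul_neg, neg_neg,
      smul_smul, mul_inv_cancel₀ hμ.ne', one_smul]

variable {T : H →ₗ.[ℝ] K} {a : H} {G : K → K}

/-- The graph of the block operator `(x, y) ↦ (x - a + T† y, -T x + G y)` with domain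
`dom T × dom T†`. -/
def blockGraph (T : H →ₗ.[ℝ] K) (a : H) (G : K → K) :
    Set (WithLp 2 (H × K) × WithLp 2 (H × K)) :=
  {p | ∃ (x : T.domain) (y : T†.domain),
    p = (WithLp.toLp 2 ((x : H), (y : K)), WithLp.toLp 2 ((x : H) - a + T† y, -(T x) + G y))}

/-- The terms with `T` and `T†` cancel in the monotonicity estimate. -/
theorem inner_blockGraph_sub (hd : Dense (T.domain : Set H)) (x x' : T.domain) (y y' : T†.domain) :
    inner ℝ
      (WithLp.toLp 2 ((x : H) - a + T† y, -(T x) + G y) -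
        WithLp.toLp 2 ((x' : H) - a + T† y', -(T x') + G y'))
      (WithLp.toLp 2 ((x : H), (y : K)) - WithLp.toLp 2 ((x' : H), (y' : K))) =
      ‖(x : H) - x'‖ ^ 2 + inner ℝ (G y - G y') ((y : K) - y') := by
  have h := LinearPMap.adjoint_isFormalAdjoint hd (y - y') (x - x')
  rw [LinearPMap.map_sub, LinearPMap.map_sub] at h
  simp only [Submodule.coe_sub] at h
  rw [WithLp.prod_inner_apply, ← real_inner_self_eq_norm_sq]
  simp only [WithLp.ofLp_fst, WithLp.ofLp_snd, WithLp.sub_fst, WithLp.sub_snd, WithLp.toLp_fst,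
    WithLp.toLp_snd]
  rw [show (x : H) - a + T† y - ((x' : H) - a + T† y') = ((x : H) - x') + (T† y - T† y') by abel,
    show -(T x) + G y - (-(T x') + G y') = (G y - G y') - (T x - T x') by abel,
    inner_add_left, inner_sub_left (G y - G y') (T x - T x'), h, real_inner_comm (T x - T x')]
  ring

/-- Banach's fixed point theorem turns the resolvent of the skew-adjoint part into one of the
perturbed operator, once `μ` exceeds the Lipschitz constant of the perturbation. -/
theorem exists_blockGraph_smul_add_eq [CompleteSpace K] (hd : Dense (T.domain : Set H))
    (hc : IsClosed (T.graph : Set (H × K))) {L : NNReal} (hG : LipschitzWith L G) :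
    ∃ μ : ℝ, 0 < μ ∧ ∀ v : WithLp 2 (H × K), ∃ p ∈ blockGraph T a G, μ • p.1 + p.2 = v := by
  -- `c` is a Lipschitz constant of `(x, y) ↦ (x - a, G y)`, and the resolvent of the skew-adjoint
  -- part has Lipschitz constant `μ⁻¹ = (c + 1)⁻¹`, so the composition is a contraction.
  set c : NNReal := L + 1 with hcdef
  set μ : ℝ := c + 1 with hμdef
  have hμ : 0 < μ := by positivity
  refine ⟨μ, hμ, fun v => ?_⟩
  set C : WithLp 2 (H × K) → WithLp 2 (H × K) := fun w => WithLp.toLp 2 (w.fst - a, G w.snd)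
    with hC
  have hCL : LipschitzWith c C := by
    refine LipschitzWith.of_dist_le_mul fun w w' => ?_
    rw [dist_eq_norm, dist_eq_norm]
    refine le_of_sq_le_sq ?_ (by positivity)
    rw [mul_pow, WithLp.prod_norm_sq_eq_of_L2, WithLp.prod_norm_sq_eq_of_L2]
    have e1 : (C w - C w').fst = w.fst - w'.fst := by simp [hC]
    have e2 : (C w - C w').snd = G w.snd - G w'.snd := by simp [hC]
    have hL : ‖G w.snd - G w'.snd‖ ≤ c * ‖w.snd - w'.snd‖ := by
      refine (hG.norm_sub_le _ _).trans ?_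
      gcongr
      simp [hcdef]
    have h2 := pow_le_pow_left₀ (norm_nonneg _) hL 2
    have hc1 : (1 : ℝ) ≤ c := by simp [hcdef]
    rw [e1, e2, WithLp.sub_fst, WithLp.sub_snd]
    nlinarith [sq_nonneg ‖w.fst - w'.fst‖, one_le_pow₀ hc1 (n := 2)]
  choose X Y hX hY using fun w : WithLp 2 (H × K) =>
    exists_smul_add_adjoint_eq T hd hc hμ w.fst w.snd
  set R : WithLp 2 (H × K) → WithLp 2 (H × K) :=
    fun w => WithLp.toLp 2 ((X w : H), (Y w : K)) with hR
  -- `R` solves `μ w + S w = v` for the skew-adjoint part `S`; since `⟪S w, w⟫ = 0`, pairing the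
  -- equation with `w` bounds `w` by `μ⁻¹ v`.
  have hRL : ∀ w w', μ * ‖R w - R w'‖ ≤ ‖w - w'‖ := by
    intro w w'
    have key : inner ℝ (w - w') (R w - R w') = μ * ‖R w - R w'‖ ^ 2 := by
      have h := LinearPMap.adjoint_isFormalAdjoint hd (Y w - Y w') (X w - X w')
      rw [LinearPMap.map_sub, LinearPMap.map_sub] at h
      simp only [Submodule.coe_sub] at h
      rw [WithLp.prod_inner_apply, WithLp.prod_norm_sq_eq_of_L2, ← real_inner_self_eq_norm_sq,
        ← real_inner_self_eq_norm_sq]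
      simp only [WithLp.ofLp_fst, WithLp.ofLp_snd, WithLp.sub_fst, WithLp.sub_snd, hR,
        WithLp.toLp_fst, WithLp.toLp_snd]
      rw [← hX w, ← hY w, ← hX w', ← hY w',
        show μ • (X w : H) + T† (Y w) - (μ • (X w' : H) + T† (Y w'))
          = μ • ((X w : H) - X w') + (T† (Y w) - T† (Y w')) by module,
        show μ • (Y w : K) - T (X w) - (μ • (Y w' : K) - T (X w'))
          = μ • ((Y w : K) - Y w') - (T (X w) - T (X w')) by module,
        inner_add_left, inner_sub_left (μ • ((Y w : K) - Y w')), h, real_inner_comm (T (X w) - T (X w')),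
        real_inner_smul_left, real_inner_smul_left]
      ring
    have hcs := real_inner_le_norm (w - w') (R w - R w')
    rw [key] at hcs
    rcases (norm_nonneg (R w - R w')).eq_or_lt with h0 | h0
    · rw [← h0]; simp
    · refine le_of_mul_le_mul_right ?_ h0
      linarith
  have hctr : ContractingWith (c / (c + 1)) fun w => R (v - C w) := by
    refine ⟨(div_lt_one (by positivity)).2 (by simp), LipschitzWith.of_dist_le_mul fun w w' => ?_⟩
    rw [dist_eq_norm, dist_eq_norm]
    have h1 := hRL (v - C w) (v - C w')
    rw [sub_sub_sub_cancel_left] at h1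
    have h2 := h1.trans (hCL.norm_sub_le _ _)
    rw [norm_sub_rev w' w] at h2
    push_cast
    rw [div_mul_eq_mul_div, le_div_iff₀ (by positivity), mul_comm]
    exact h2
  set w := hctr.fixedPoint
  have hw : R (v - C w) = w := hctr.fixedPoint_isFixedPt
  refine ⟨_, ⟨X (v - C w), Y (v - C w), rfl⟩, ?_⟩
  have e1 : (X (v - C w) : H) = w.fst := congrArg WithLp.fst hw
  have e2 : (Y (v - C w) : K) = w.snd := congrArg WithLp.snd hw
  have h1 := hX (v - C w)
  have h2 := hY (v - C w)
  refine (WithLp.ofLp_injective 2) (Prod.ext ?_ ?_)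
  · change μ • (X (v - C w) : H) + ((X (v - C w) : H) - a + T† (Y (v - C w))) = v.fst
    rw [show μ • (X (v - C w) : H) + ((X (v - C w) : H) - a + T† (Y (v - C w)))
      = (μ • (X (v - C w) : H) + T† (Y (v - C w))) + ((X (v - C w) : H) - a) by abel, h1, e1]
    simp [hC]
  · change μ • (Y (v - C w) : K) + (-T (X (v - C w)) + G (Y (v - C w))) = v.snd
    rw [← add_assoc, ← sub_eq_add_neg, h2, e2]
    simp [hC]

/-- If `G` is monotone and Lipschitz, the block operator is maximally monotone. -/
theorem isMaximallyMonotone_blockGraph [CompleteSpace K] (hd : Dense (T.domain : Set H))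
    (hc : IsClosed (T.graph : Set (H × K))) {L : NNReal} (hG : LipschitzWith L G)
    (hmono : ∀ y y', 0 ≤ inner ℝ (G y - G y') (y - y')) :
    IsMaximallyMonotone (blockGraph T a G) := by
  refine ⟨?_, fun N hN hsub => Subset.antisymm ?_ hsub⟩
  · rintro _ _ _ _ ⟨x, y, h⟩ ⟨x', y', h'⟩
    obtain ⟨rfl, rfl⟩ := Prod.mk.inj h
    obtain ⟨rfl, rfl⟩ := Prod.mk.inj h'
    rw [inner_blockGraph_sub hd]
    exact add_nonneg (sq_nonneg _) (hmono _ _)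
  · -- Minty's argument: compare `(w, v)` with the point of the graph that has the same `μ w + v`.
    rintro ⟨w, v⟩ hwv
    obtain ⟨μ, hμ, hsurj⟩ := exists_blockGraph_smul_add_eq (a := a) hd hc hG
    obtain ⟨⟨z, u⟩, hp, hzu⟩ := hsurj (μ • w + v)
    have h := hN _ _ _ _ hwv (hsub hp)
    have hvu : v - u = -(μ • (w - z)) := by
      simp only at hzu
      rw [sub_eq_iff_eq_add, smul_sub, neg_sub, ← add_right_inj (μ • w), ← hzu]
      abel
    rw [hvu, inner_neg_left, real_inner_smul_left, real_inner_self_eq_norm_sq] at h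
    have h0 : ‖w - z‖ ^ 2 = 0 := le_antisymm (by nlinarith [sq_nonneg ‖w - z‖]) (sq_nonneg _)
    have hwz : w - z = 0 := by simpa using h0
    rw [hwz, smul_zero, neg_zero, sub_eq_zero] at hvu
    rw [sub_eq_zero.1 hwz, hvu]
    exact hp

/-- Monotonicity is strict in the first component, and density of the range of `T` recovers the
second component from `T† y`. -/
theorem blockGraph_injective (hd : Dense (T.domain : Set H))
    (hr : ∀ y : K, (∀ x : T.domain, inner ℝ y (T x) = 0) → y = 0)
    (hmono : ∀ y y', 0 ≤ inner ℝ (G y - G y') (y - y'))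
    {w w' v : WithLp 2 (H × K)} (hw : (w, v) ∈ blockGraph T a G)
    (hw' : (w', v) ∈ blockGraph T a G) : w = w' := by
  obtain ⟨x, y, h⟩ := hw
  obtain ⟨x', y', h'⟩ := hw'
  obtain ⟨rfl, rfl⟩ := Prod.mk.inj h
  obtain ⟨rfl, hv⟩ := Prod.mk.inj h'
  have key := inner_blockGraph_sub (a := a) (G := G) hd x x' y y'
  rw [← hv, sub_self, inner_zero_left] at key
  have hx : ‖(x : H) - x'‖ ^ 2 = 0 :=
    le_antisymm (by linarith [hmono y y']) (sq_nonneg _)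
  have hx : (x : H) = x' := sub_eq_zero.1 (by simpa using hx)
  have h1 : (x : H) - a + T† y = x' - a + T† y' := congrArg WithLp.fst hv
  rw [hx, add_right_inj] at h1
  have hy : (y : K) - y' = 0 := hr _ fun z => by
    have := LinearPMap.adjoint_isFormalAdjoint hd (y - y') z
    rw [LinearPMap.map_sub, h1, sub_self, inner_zero_left] at this
    exact this.symm
  rw [hx, sub_eq_zero.1 hy]

end BlockOperator

/-! ### Firm nonexpansiveness of the metric projection -/

section Projection

variable {X : Type*} [NormedAddCommGroup X] [InnerProductSpace ℝ X] [CompleteSpace X] {F : Set X}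

theorem inner_sub_metricProj_nonpos (hne : F.Nonempty) (hcl : IsClosed F) (hconv : Convex ℝ F)
    (u : X) {w : X} (hw : w ∈ F) : inner ℝ (u - metricProj F u) (w - metricProj F u) ≤ 0 := by
  obtain ⟨hP, hmin⟩ := metricProj_spec hne hcl hconv u
  have : Nonempty F := hne.to_subtype
  refine (norm_eq_iInf_iff_real_inner_le_zero hconv hP).1 (le_antisymm ?_ ?_) w hw
  · exact le_ciInf fun v => hmin v v.2
  · exact ciInf_le ⟨0, by rintro _ ⟨_, rfl⟩; positivity⟩ (⟨_, hP⟩ : F)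

/-- Firm nonexpansiveness: add the variational inequalities of the two projections. -/
theorem sq_norm_metricProj_sub_le (hne : F.Nonempty) (hcl : IsClosed F) (hconv : Convex ℝ F)
    (u v : X) : ‖metricProj F u - metricProj F v‖ ^ 2 ≤
      inner ℝ (metricProj F u - metricProj F v) (u - v) := by
  have h1 := inner_sub_metricProj_nonpos hne hcl hconv u (metricProj_spec hne hcl hconv v).1
  have h2 := inner_sub_metricProj_nonpos hne hcl hconv v (metricProj_spec hne hcl hconv u).1
  set p := metricProj F u
  set q := metricProj F v
  have h3 : inner ℝ (u - p) (q - p) + inner ℝ (v - q) (p - q)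
      = ‖p - q‖ ^ 2 - inner ℝ (p - q) (u - v) := by
    rw [← neg_sub p q, inner_neg_right, ← real_inner_self_eq_norm_sq, real_inner_comm (p - q),
      real_inner_comm (p - q) (v - q), ← sub_eq_neg_add, ← inner_sub_right, ← inner_sub_right]
    congr 1
    abel
  linarith

theorem lipschitzWith_metricProj (hne : F.Nonempty) (hcl : IsClosed F) (hconv : Convex ℝ F) :
    LipschitzWith 1 (metricProj F) := by
  refine LipschitzWith.of_dist_le_mul fun u v => ?_
  rw [dist_eq_norm, dist_eq_norm, NNReal.coe_one, one_mul]
  have h := (sq_norm_metricProj_sub_le hne hcl hconv u v).trans (real_inner_le_norm _ _)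
  rcases (norm_nonneg (metricProj F u - metricProj F v)).eq_or_lt with h0 | h0
  · rw [← h0]; exact norm_nonneg _
  · exact le_of_mul_le_mul_left (by rwa [sq] at h) h0

end Projection

/-! ### The Volterra operator and the graph of the state operator -/

/-- The adjoint of multiplication with `Q` is multiplication with `Qᵀ`. -/
theorem inner_mulL2_left {T : ℝ} {k l : ℕ} (Q : Matrix (Fin k) (Fin l) ℝ) (x : L2 T l)
    (y : L2 T k) : inner ℝ (mulL2 T Q x) y = inner ℝ x (mulL2 T Q.transpose y) := by
  rw [L2.inner_def, L2.inner_def]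
  refine integral_congr_ae ?_
  filter_upwards [ContinuousLinearMap.coeFn_compLpL
      (LinearMap.toContinuousLinearMap (Matrix.toEuclideanLin Q)) x,
    ContinuousLinearMap.coeFn_compLpL
      (LinearMap.toContinuousLinearMap (Matrix.toEuclideanLin Q.transpose)) y] with t h1 h2
  simp only [mulL2, h1, h2]
  rw [← Matrix.conjTranspose_eq_transpose_of_trivial, Matrix.toEuclideanLin_conjTranspose_eq_adjoint]
  exact (LinearMap.adjoint_inner_right _ _ _).symm

theorem memLp_of_continuousOn {E : Type*} [NormedAddCommGroup E] {T : ℝ} {f : ℝ → E}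
    (hf : ContinuousOn f (Icc 0 T)) : MemLp f 2 (volume.restrict (Ioo 0 T)) := by
  obtain ⟨C, hC⟩ := isCompact_Icc.exists_bound_of_continuousOn hf
  refine MemLp.of_bound
    ((hf.mono Ioo_subset_Icc_self).aestronglyMeasurable measurableSet_Ioo) C ?_
  filter_upwards [ae_restrict_mem measurableSet_Ioo] with t ht
  exact hC t (Ioo_subset_Icc_self ht)

theorem continuousOn_primitive_Icc {E : Type*} [NormedAddCommGroup E] [NormedSpace ℝ E]
    {T : ℝ} (hT : 0 < T) {g : ℝ → E}
    (hg : IntegrableOn g (Ioo 0 T)) :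
    ContinuousOn (fun t => ∫ s in (0 : ℝ)..t, g s) (Icc 0 T) := by
  have hg' : IntegrableOn g (Icc 0 T) := (integrableOn_Icc_iff_integrableOn_Ioo).2 hg
  exact intervalIntegral.continuousOn_primitive_interval (by rwa [uIcc_of_le hT.le]) |>.mono
      (by rw [uIcc_of_le hT.le])

/-- The Cauchy-Schwarz bound of the `L¹` norm on `(0, T)` by the `L²` norm; the factor is
`√T`. -/
theorem integral_norm_le_L2 {T : ℝ} {k : ℕ} (g : L2 T k) :
    ∫ t in Ioo 0 T, ‖g t‖ ≤
      ((volume.restrict (Ioo 0 T)) univ ^ (1 / (1 : ENNReal).toReal - 1 / (2 : ENNReal).toReal)).toReal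
        * ‖g‖ := by
  have hm := (Lp.memLp g).aestronglyMeasurable
  rw [integral_norm_eq_lintegral_enorm hm, ← eLpNorm_one_eq_lintegral_enorm, Lp.norm_def, mul_comm,
    ← ENNReal.toReal_mul]
  refine ENNReal.toReal_mono ?_ (eLpNorm_le_eLpNorm_mul_rpow_measure_univ (by norm_num) hm)
  refine ENNReal.mul_ne_top (Lp.eLpNorm_ne_top g) (ENNReal.rpow_ne_top_of_nonneg (by norm_num) ?_)
  exact measure_ne_top _ _

theorem intervalIntegrable_of_integrableOn_Ioo {E : Type*} [NormedAddCommGroup E] {T : ℝ}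
    {g : ℝ → E} (hg : IntegrableOn g (Ioo 0 T)) {t : ℝ} (ht : t ∈ Ioo 0 T) :
    IntervalIntegrable g volume 0 t := by
  rw [intervalIntegrable_iff_integrableOn_Ioo_of_le ht.1.le]
  exact hg.mono_set (Ioo_subset_Ioo_right ht.2.le)

/-- The Volterra operator `(V g)(t) = ∫₀ᵗ g`. -/
noncomputable def volterra {T : ℝ} (hT : 0 < T) (k : ℕ) : L2 T k →L[ℝ] L2 T k :=
  LinearMap.mkContinuousOfExistsBound
    { toFun := fun g => (memLp_of_continuousOn
        (continuousOn_primitive_Icc hT (integrableOn_L2 g))).toLp _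
      map_add' := fun g h => by
        rw [← MemLp.toLp_add]
        refine MemLp.toLp_congr _ _ ?_
        filter_upwards [ae_restrict_mem measurableSet_Ioo] with t ht
        rw [Pi.add_apply, ← intervalIntegral.integral_add
          (intervalIntegrable_of_integrableOn_Ioo (integrableOn_L2 g) ht)
          (intervalIntegrable_of_integrableOn_Ioo (integrableOn_L2 h) ht)]
        rw [intervalIntegral.integral_of_le ht.1.le, intervalIntegral.integral_of_le ht.1.le,
          integral_Ioc_eq_integral_Ioo, integral_Ioc_eq_integral_Ioo]
        exact integral_congr_ae (ae_restrict_of_ae_restrict_of_subset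
          (Ioo_subset_Ioo_right ht.2.le) (Lp.coeFn_add g h))
      map_smul' := fun r g => by
        rw [RingHom.id_apply, ← MemLp.toLp_const_smul]
        refine MemLp.toLp_congr _ _ ?_
        filter_upwards [ae_restrict_mem measurableSet_Ioo] with t ht
        rw [Pi.smul_apply, ← intervalIntegral.integral_smul]
        rw [intervalIntegral.integral_of_le ht.1.le, intervalIntegral.integral_of_le ht.1.le,
          integral_Ioc_eq_integral_Ioo, integral_Ioc_eq_integral_Ioo]
        exact integral_congr_ae (ae_restrict_of_ae_restrict_of_subset
          (Ioo_subset_Ioo_right ht.2.le) (Lp.coeFn_smul r g)) }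
    (by
      refine ⟨measureUnivNNReal (volume.restrict (Ioo 0 T)) ^ (2 : ENNReal).toReal⁻¹ *
        ((volume.restrict (Ioo 0 T)) univ ^
          (1 / (1 : ENNReal).toReal - 1 / (2 : ENNReal).toReal)).toReal, fun g => ?_⟩
      rw [mul_assoc]
      refine (Lp.norm_le_of_ae_bound (by positivity) ?_).trans
        (mul_le_mul_of_nonneg_left (integral_norm_le_L2 g) (by positivity))
      filter_upwards [MemLp.coeFn_toLp (memLp_of_continuousOn
        (continuousOn_primitive_Icc hT (integrableOn_L2 g))),
        ae_restrict_mem measurableSet_Ioo] with t h ht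
      refine (congrArg norm h).trans_le ?_
      rw [intervalIntegral.integral_of_le ht.1.le, integral_Ioc_eq_integral_Ioo]
      refine (norm_integral_le_integral_norm _).trans ?_
      exact setIntegral_mono_set (integrableOn_L2 g).norm
        (Filter.Eventually.of_forall fun _ => norm_nonneg _)
        (Ioo_subset_Ioo_right ht.2.le).eventuallyLE)

theorem coeFn_volterra {T : ℝ} (hT : 0 < T) {k : ℕ} (g : L2 T k) :
    volterra hT k g =ᵐ[volume.restrict (Ioo 0 T)] fun t => ∫ s in (0 : ℝ)..t, g s :=
  (memLp_of_continuousOn (continuousOn_primitive_Icc hT (integrableOn_L2 g))).coeFn_toLp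

theorem isContRep_volterra_add_const {T : ℝ} (hT : 0 < T) {k : ℕ} (g : L2 T k) (c : Vec k) :
    IsContRep T (volterra hT k g + constL2 T c : L2 T k)
      fun t => (∫ s in (0 : ℝ)..t, g s) + c := by
  refine ⟨(continuousOn_primitive_Icc hT (integrableOn_L2 g)).add continuousOn_const, ?_⟩
  filter_upwards [Lp.coeFn_add (volterra hT k g) (constL2 T c), coeFn_volterra hT g,
    Lp.coeFn_const (p := 2) (μ := volume.restrict (Ioo 0 T)) c] with t h1 h2 h3
  rw [h1, Pi.add_apply, h2]
  congr 1

theorem hasWeakDeriv_const {E : Type*} [NormedAddCommGroup E] [NormedSpace ℝ E] [CompleteSpace E]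
    {T : ℝ} (c : E) : HasWeakDeriv T (fun _ => c) 0 := by
  intro φ hφ
  rw [integral_smul_const]
  rcases le_or_gt T 0 with hT | hT
  · simp [Ioo_eq_empty_of_le hT]
  have h := intervalIntegral.integral_deriv_eq_sub (a := 0) (b := T)
    (fun x _ => (hφ.1.differentiable (by simp)).differentiableAt (x := x))
    ((hφ.1.continuous_deriv (by simp)).intervalIntegrable _ _)
  rw [intervalIntegral.integral_of_le hT.le, integral_Ioc_eq_integral_Ioo,
    hφ.eq_zero (t := T) (by simp), hφ.eq_zero (t := 0) (by simp)] at h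
  simp [h]

theorem hasWeakDeriv_volterra_add_const {T : ℝ} (hT : 0 < T) {k : ℕ} (g : L2 T k) (c : Vec k) :
    HasWeakDeriv T (volterra hT k g + constL2 T c : L2 T k) g := by
  have h1 : HasWeakDeriv T (volterra hT k g) g :=
    (hasWeakDeriv_primitive (integrableOn_L2 g)).congr (coeFn_volterra hT g).symm
      (Filter.EventuallyEq.refl _ _)
  have h2 : HasWeakDeriv T (constL2 T c) (0 : L2 T k) :=
    (hasWeakDeriv_const c).congr
      (Lp.coeFn_const (p := 2) (μ := volume.restrict (Ioo 0 T)) c).symm (Lp.coeFn_zero _ _ _).symm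
  simpa using hasWeakDeriv_add h1 h2

/-- The fundamental theorem of calculus in `H¹`: a function with weak derivative `g` is of the form
`V g + c`. -/
theorem HasWeakDeriv.exists_eq_volterra_add_const {T : ℝ} (hT : 0 < T) {k : ℕ} {x g : L2 T k}
    (h : HasWeakDeriv T x g) : ∃ c : Vec k, x = volterra hT k g + constL2 T c := by
  have h0 : HasWeakDeriv T (x - volterra hT k g : L2 T k) (0 : L2 T k) := by
    have h1 : HasWeakDeriv T (volterra hT k g) g := by
      simpa [constL2] using hasWeakDeriv_volterra_add_const hT g 0
    simpa [sub_eq_add_neg] using hasWeakDeriv_add h (hasWeakDeriv_smul (-1) h1)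
  obtain ⟨c, hc⟩ := ae_eq_const_of_hasWeakDeriv_zero hT (integrableOn_L2 _)
    (h0.congr (Filter.EventuallyEq.refl _ _) (Lp.coeFn_zero _ _ _))
  refine ⟨c, eq_add_of_sub_eq' (Lp.ext ?_)⟩
  filter_upwards [hc, Lp.coeFn_const (p := 2) (μ := volume.restrict (Ioo 0 T)) c] with t h1 h2
  rw [h1]
  exact h2.symm

theorem weakDeriv_eq {T : ℝ} {k : ℕ} (x : H1 T k) {g : L2 T k} (h : HasWeakDeriv T (x : L2 T k) g) :
    weakDeriv T k x = g :=
  H1.weakDeriv_unique x.2.choose_spec h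

theorem initialValue_eq {T : ℝ} (hT : 0 < T) {k : ℕ} (x : H1 T k) {c : ℝ → Vec k}
    (h : IsContRep T (x : L2 T k) c) : initialValue hT k x = c 0 :=
  (H1.exists_isContRep hT x).choose_spec.eqOn hT h (left_mem_Icc.2 hT.le)

theorem stateOp_apply {T : ℝ} (hT : 0 < T) {n : ℕ} (A : Matrix (Fin n) (Fin n) ℝ)
    (x : (stateOp hT A).domain) : stateOp hT A x =
      WithLp.toLp 2 (weakDeriv T n x - mulL2 T A (x : L2 T n), initialValue hT n x) :=
  rfl

/-- The graph of `𝒜` in integrated form: `𝒜 x = (h, c)` if and only if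
`x(t) = c + ∫₀ᵗ (h + A x)`. -/
theorem mem_graph_stateOp_iff {T : ℝ} (hT : 0 < T) {n : ℕ} (A : Matrix (Fin n) (Fin n) ℝ)
    (x : L2 T n) (z : WithLp 2 (L2 T n × Vec n)) :
    (x, z) ∈ (stateOp hT A).graph ↔
      x = volterra hT n (z.fst + mulL2 T A x) + constL2 T z.snd := by
  rw [LinearPMap.mem_graph_iff]
  constructor
  · rintro ⟨y, rfl, rfl⟩
    obtain ⟨y, g, hg⟩ := y
    obtain ⟨c, hc⟩ := hg.exists_eq_volterra_add_const hT
    have hc0 : initialValue hT n ⟨y, g, hg⟩ = c := by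
      rw [initialValue_eq hT ⟨y, g, hg⟩ (c := fun t => (∫ s in (0 : ℝ)..t, g s) + c)]
      · simp
      · change IsContRep T y _
        rw [hc]
        exact isContRep_volterra_add_const hT g c
    rw [stateOp_apply, WithLp.toLp_fst, WithLp.toLp_snd]
    erw [hc0, weakDeriv_eq ⟨y, g, hg⟩ hg]
    rw [sub_add_cancel]
    exact hc
  · intro h
    have hw := hasWeakDeriv_volterra_add_const hT (z.fst + mulL2 T A x) z.snd
    have hr := isContRep_volterra_add_const hT (z.fst + mulL2 T A x) z.snd
    rw [← h] at hw hr
    refine ⟨⟨x, _, hw⟩, rfl, ?_⟩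
    rw [stateOp_apply]
    refine WithLp.ofLp_injective 2 (Prod.ext ?_ ?_)
    · change weakDeriv T n ⟨x, _, hw⟩ - mulL2 T A x = z.fst
      rw [weakDeriv_eq _ hw, add_sub_cancel_right]
    · change initialValue hT n ⟨x, _, hw⟩ = z.snd
      rw [initialValue_eq hT _ hr]
      simp

/-- The integrated form of the graph involves only bounded operators, so it is a closed
condition. -/
theorem isClosed_graph_stateOp {T : ℝ} (hT : 0 < T) {n : ℕ} (A : Matrix (Fin n) (Fin n) ℝ) :
    IsClosed ((stateOp hT A).graph : Set (L2 T n × WithLp 2 (L2 T n × Vec n))) := by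
  have : ((stateOp hT A).graph : Set (L2 T n × WithLp 2 (L2 T n × Vec n))) =
      {p | p.1 = volterra hT n (p.2.fst + mulL2 T A p.1) + constL2 T p.2.snd} := by
    ext ⟨x, z⟩
    exact mem_graph_stateOp_iff hT A x z
  rw [this]
  have h1 : Continuous fun p : L2 T n × WithLp 2 (L2 T n × Vec n) => p.2.fst :=
    (WithLp.continuous_fst 2 _ _).comp continuous_snd
  have h2 : Continuous fun p : L2 T n × WithLp 2 (L2 T n × Vec n) => p.2.snd :=
    (WithLp.continuous_snd 2 _ _).comp continuous_snd
  have h3 : Continuous (constL2 T (k := n)) :=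
    (Lp.constL 2 (volume.restrict (Ioo 0 T)) ℝ : Vec n →L[ℝ] L2 T n).continuous
  refine isClosed_eq continuous_fst (((volterra hT n).continuous.comp
    (h1.add ((mulL2 T A).continuous.comp continuous_fst))).add (h3.comp h2))

/-! ### Density of the domain and of the range of the state operator -/

/-- The variation of constants formula: the inhomogeneous linear equation `x' = L x + w`,
`x(0) = c`, is solvable. -/
theorem exists_hasDerivAt_linear {E : Type*} [NormedAddCommGroup E] [NormedSpace ℝ E]
    [CompleteSpace E] (L : E →L[ℝ] E) {w : ℝ → E} (hw : Continuous w) (c : E) :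
    ∃ x : ℝ → E, x 0 = c ∧ ∀ t, HasDerivAt x (L (x t) + w t) t := by
  let : NormedAlgebra ℚ (E →L[ℝ] E) := NormedAlgebra.restrictScalars ℚ ℝ _
  set U : ℝ → E →L[ℝ] E := fun t => NormedSpace.exp (t • L) with hU
  have hUd : ∀ t, HasDerivAt U (L * U t) t := fun t => hasDerivAt_exp_smul_const' L t
  have hUc : Continuous U := continuous_iff_continuousAt.2 fun t => (hUd t).continuousAt
  have hUinv : ∀ t, U t * U (-t) = 1 := fun t => by
    simp only [hU]
    rw [← NormedSpace.exp_add_of_commute, neg_smul, add_neg_cancel, NormedSpace.exp_zero]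
    rw [neg_smul]
    exact (Commute.refl _).neg_right
  have hvc : Continuous fun s => U (-s) (w s) := (hUc.comp continuous_neg).clm_apply hw
  refine ⟨fun t => U t (c + ∫ s in (0 : ℝ)..t, U (-s) (w s)), by simp [hU], fun t => ?_⟩
  have hI : HasDerivAt (fun t => c + ∫ s in (0 : ℝ)..t, U (-s) (w s)) (U (-t) (w t)) t :=
    (intervalIntegral.integral_hasDerivAt_right (hvc.intervalIntegrable _ _)
      hvc.stronglyMeasurable.stronglyMeasurableAtFilter hvc.continuousAt).const_add c
  have h := (hUd t).clm_apply hI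
  have hinv : U t (U (-t) (w t)) = w t := DFunLike.congr_fun (hUinv t) (w t)
  rw [hinv] at h
  exact h

/-- A function in `L²` that is orthogonal to all `φ v` with a test function `φ` and a vector `v`
vanishes. -/
theorem L2_eq_zero_of_inner_testFun {T : ℝ} {k : ℕ} (y : L2 T k)
    (h : ∀ φ, IsTestFun T φ → ∀ (v : Vec k) (z : L2 T k),
      z =ᵐ[volume.restrict (Ioo 0 T)] (fun t => φ t • v) → inner ℝ y z = 0) : y = 0 := by
  have key : ∀ᵐ t, t ∈ Ioo 0 T → y t = 0 := by
    refine isOpen_Ioo.ae_eq_zero_of_integral_contDiff_smul_eq_zero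
      (integrableOn_L2 y).locallyIntegrableOn fun φ hφ hφc hφs => ?_
    have hφt : IsTestFun T φ := ⟨hφ, hφc, hφs⟩
    rw [← setIntegral_eq_integral_of_forall_compl_eq_zero (s := Ioo 0 T) fun t ht => by
      rw [hφt.eq_zero ht, zero_smul]]
    refine ext_inner_left ℝ fun v => ?_
    rw [inner_zero_right, ← integral_inner (hφt.integrable (integrableOn_L2 y))]
    have hm := memLp_of_continuousOn (T := T) (f := fun t => φ t • v)
      (hφ.continuous.smul continuous_const).continuousOn
    refine Eq.trans ?_ (h φ hφt v _ hm.coeFn_toLp)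
    rw [L2.inner_def]
    refine integral_congr_ae ?_
    filter_upwards [hm.coeFn_toLp] with t ht
    rw [ht, inner_smul_right, inner_smul_right, real_inner_comm]
  refine Lp.ext ?_
  refine Filter.EventuallyEq.trans ?_ (Lp.coeFn_zero _ _ _).symm
  rw [Filter.EventuallyEq, ae_restrict_iff' measurableSet_Ioo]
  exact key

theorem eq_volterra_add_const_of_hasDerivAt {T : ℝ} (hT : 0 < T) {k : ℕ} {x x' : ℝ → Vec k}
    (hx : ∀ t, HasDerivAt x (x' t) t) (hx' : Continuous x') {X X' : L2 T k}
    (hX : X =ᵐ[volume.restrict (Ioo 0 T)] x) (hX' : X' =ᵐ[volume.restrict (Ioo 0 T)] x') :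
    X = volterra hT k X' + constL2 T (x 0) := by
  refine Lp.ext ?_
  filter_upwards [hX, (isContRep_volterra_add_const hT X' (x 0)).2,
    ae_restrict_mem measurableSet_Ioo] with t h1 h2 ht
  have h3 : ∫ s in (0 : ℝ)..t, X' s = ∫ s in (0 : ℝ)..t, x' s := by
    rw [intervalIntegral.integral_of_le ht.1.le, intervalIntegral.integral_of_le ht.1.le,
      integral_Ioc_eq_integral_Ioo, integral_Ioc_eq_integral_Ioo]
    exact integral_congr_ae (ae_restrict_of_ae_restrict_of_subset
      (Ioo_subset_Ioo_right ht.2.le) hX')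
  rw [h1, h2, h3, intervalIntegral.integral_eq_sub_of_hasDerivAt (fun s _ => hx s)
    (hx'.intervalIntegrable _ _), sub_add_cancel]

/-- `H¹` contains all `φ v` with a test function `φ` and a vector `v`. -/
theorem dense_H1 {T : ℝ} (hT : 0 < T) (k : ℕ) : Dense (H1 T k : Set (L2 T k)) := by
  rw [Submodule.dense_iff_topologicalClosure_eq_top, Submodule.topologicalClosure_eq_top_iff,
    Submodule.eq_bot_iff]
  intro y hy
  refine L2_eq_zero_of_inner_testFun y fun φ hφ v z hz => ?_
  refine (Submodule.mem_orthogonal' _ _).1 hy z ?_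
  have hd : ∀ t, HasDerivAt (fun t => φ t • v) (deriv φ t • v) t := fun t =>
    ((hφ.1.differentiable (by simp)).differentiableAt.hasDerivAt).smul_const v
  have hc : Continuous fun t => deriv φ t • v :=
    (hφ.1.continuous_deriv (by simp)).smul continuous_const
  have h := eq_volterra_add_const_of_hasDerivAt hT hd hc hz
    (memLp_of_continuousOn hc.continuousOn).coeFn_toLp
  rw [h]
  exact ⟨_, hasWeakDeriv_volterra_add_const hT _ _⟩

/-- `𝒜` maps onto the pairs `(w, c)` with `w` continuous. -/
theorem exists_stateOp_eq {T : ℝ} (hT : 0 < T) {n : ℕ} (A : Matrix (Fin n) (Fin n) ℝ)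
    {w : ℝ → Vec n} (hw : Continuous w) {z : L2 T n} (hz : z =ᵐ[volume.restrict (Ioo 0 T)] w)
    (c : Vec n) : ∃ x : (stateOp hT A).domain, stateOp hT A x = WithLp.toLp 2 (z, c) := by
  set L := LinearMap.toContinuousLinearMap (Matrix.toEuclideanLin A)
  obtain ⟨x, rfl, hx⟩ := exists_hasDerivAt_linear L hw c
  have hxc : Continuous x := continuous_iff_continuousAt.2 fun t => (hx t).continuousAt
  have hX := (memLp_of_continuousOn (T := T) hxc.continuousOn).coeFn_toLp
  set X : L2 T n := (memLp_of_continuousOn (T := T) hxc.continuousOn).toLp x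
  have hX' : (z + mulL2 T A X : L2 T n) =ᵐ[volume.restrict (Ioo 0 T)]
      fun t => L (x t) + w t := by
    filter_upwards [Lp.coeFn_add z (mulL2 T A X), hz, hX, ContinuousLinearMap.coeFn_compLpL L X]
      with t h1 h2 h3 h4
    have h4 : mulL2 T A X t = L (X t) := h4
    rw [h1, Pi.add_apply, h2, h4, h3, add_comm]
  have h := eq_volterra_add_const_of_hasDerivAt hT hx ((L.continuous.comp hxc).add hw) hX hX'
  obtain ⟨u, -, hu⟩ := (LinearPMap.mem_graph_iff _).1
    ((mem_graph_stateOp_iff hT A X (WithLp.toLp 2 (z, x 0))).2 h)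
  exact ⟨u, hu⟩

/-- The range of `𝒜` is dense: it contains `(0, c)` and `(φ v, 0)` for all vectors `c`, `v` and test
functions `φ`. -/
theorem eq_zero_of_inner_stateOp {T : ℝ} (hT : 0 < T) {n : ℕ} (A : Matrix (Fin n) (Fin n) ℝ)
    (y : WithLp 2 (L2 T n × Vec n))
    (h : ∀ x : (stateOp hT A).domain, inner ℝ y (stateOp hT A x) = 0) : y = 0 := by
  have h2 : y.snd = 0 := by
    obtain ⟨x, hx⟩ := exists_stateOp_eq hT A (w := 0) continuous_zero (Lp.coeFn_zero _ _ _) y.snd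
    have := h x
    rw [hx, WithLp.prod_inner_apply] at this
    simpa using this
  have h1 : y.fst = 0 := L2_eq_zero_of_inner_testFun y.fst fun φ hφ v z hz => by
    obtain ⟨x, hx⟩ := exists_stateOp_eq hT A (hφ.1.continuous.smul continuous_const) hz 0
    have := h x
    rw [hx, WithLp.prod_inner_apply] at this
    simpa using this
  exact WithLp.ofLp_injective 2 (Prod.ext h1 h2)

/-! ### The optimality system -/

/-- The map `(λ, λ₀) ↦ (B P_F(α⁻¹ B* λ + u_ref), x₀)`, which is the part of the second component of
the optimality system that does not involve `𝒜`. -/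
noncomputable def controlMap {T : ℝ} {n m : ℕ} (B : Matrix (Fin n) (Fin m) ℝ) (α : ℝ) (F : Set (L2 T m))
    (uref : Vec m) (x₀ : Vec n) (y : WithLp 2 (L2 T n × Vec n)) : WithLp 2 (L2 T n × Vec n) :=
  WithLp.toLp 2
      (mulL2 T B (metricProj F (α⁻¹ • mulL2 T B.transpose y.fst + constL2 T uref)), 0)
    + WithLp.toLp 2 (0, x₀)

section ControlMap

variable {T : ℝ} {n m : ℕ} (B : Matrix (Fin n) (Fin m) ℝ) (α : ℝ) {F : Set (L2 T m)}
  (uref : Vec m) (x₀ : Vec n)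

theorem lipschitzWith_controlMap (hne : F.Nonempty) (hcl : IsClosed F) (hconv : Convex ℝ F) :
    ∃ L, LipschitzWith L (controlMap B α F uref x₀) := by
  have h1 : LipschitzWith _ fun y : WithLp 2 (L2 T n × Vec n) =>
      α⁻¹ • mulL2 T B.transpose y.fst + constL2 T uref :=
    ((α⁻¹ • mulL2 T B.transpose).comp (WithLp.fstL 2 ℝ (L2 T n) (Vec n))).lipschitz.add
      (LipschitzWith.const (constL2 T uref))
  have h2 := (mulL2 T B).lipschitz.comp ((lipschitzWith_metricProj hne hcl hconv).comp h1)
  refine ⟨_, LipschitzWith.of_dist_le_mul fun y y' =>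
    le_of_eq_of_le ?_ (h2.dist_le_mul y y')⟩
  rw [controlMap, controlMap, dist_add_right, WithLp.dist_toLp_fst]
  rfl

variable {α} in
/-- Moving `B` to the other side of the inner product leaves `α` times the monotonicity estimate
of the projection. -/
theorem inner_controlMap_sub_nonneg (hα : 0 < α) (hne : F.Nonempty) (hcl : IsClosed F)
    (hconv : Convex ℝ F) (y y' : WithLp 2 (L2 T n × Vec n)) :
    0 ≤ inner ℝ (controlMap B α F uref x₀ y - controlMap B α F uref x₀ y') (y - y') := by
  rw [controlMap, controlMap, add_sub_add_right_eq_sub, WithLp.prod_inner_apply]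
  simp only [WithLp.ofLp_fst, WithLp.ofLp_snd, WithLp.sub_fst, WithLp.sub_snd, WithLp.toLp_fst,
    WithLp.toLp_snd, sub_self, inner_zero_left, add_zero]
  rw [← map_sub, inner_mulL2_left]
  have h := sq_norm_metricProj_sub_le hne hcl hconv
    (α⁻¹ • mulL2 T B.transpose y.fst + constL2 T uref)
    (α⁻¹ • mulL2 T B.transpose y'.fst + constL2 T uref)
  rw [add_sub_add_right_eq_sub, ← smul_sub, ← map_sub, inner_smul_right] at h
  exact nonneg_of_mul_nonneg_right ((sq_nonneg _).trans h) (inv_pos.2 hα)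

end ControlMap

theorem operatorGraph_optOp {T : ℝ} (hT : 0 < T) {n m : ℕ} (A : Matrix (Fin n) (Fin n) ℝ)
    (B : Matrix (Fin n) (Fin m) ℝ) (α : ℝ) (F : Set (L2 T m)) (xref : Vec n) (uref : Vec m)
    (x₀ : Vec n) : operatorGraph (optOp hT A B α F xref uref x₀) =
      blockGraph (stateOp hT A) (constL2 T xref) (controlMap B α F uref x₀) := by
  ext p
  constructor
  · rintro ⟨⟨w, hw1, hw2⟩, rfl⟩
    exact ⟨⟨w.fst, hw1⟩, ⟨w.snd, hw2⟩, Prod.ext rfl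
      (congrArg (fun z => WithLp.toLp 2 (_, z)) (add_assoc _ _ _))⟩
  · rintro ⟨x, y, rfl⟩
    exact ⟨⟨WithLp.toLp 2 (x, y), x.2, y.2⟩, Prod.ext rfl
      (congrArg (fun z => WithLp.toLp 2 (_, z)) (add_assoc _ _ _).symm)⟩

end OptSys

theorem mainTheorem2 {n m : ℕ} {T : ℝ} (hT : 0 < T) (A : Matrix (Fin n) (Fin n) ℝ)
    (B : Matrix (Fin n) (Fin m) ℝ) (α : ℝ) (hα : 0 < α)
    (F : Set (OptSys.L2 T m)) (hFconv : Convex ℝ F) (hFclosed : IsClosed F)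
    (xref : OptSys.Vec n) (uref : OptSys.Vec m) (huref : OptSys.constL2 T uref ∈ F)
    (x₀ : OptSys.Vec n) :
    OptSys.IsMaximallyMonotone
        (OptSys.operatorGraph (OptSys.optOp hT A B α F xref uref x₀)) ∧
      Function.Injective (OptSys.optOp hT A B α F xref uref x₀) := by
  have hne : F.Nonempty := ⟨_, huref⟩
  have hmono := OptSys.inner_controlMap_sub_nonneg B uref x₀ hα hne hFclosed hFconv
  obtain ⟨L, hL⟩ := OptSys.lipschitzWith_controlMap B α uref x₀ hne hFclosed hFconv
  refine ⟨?_, fun w w' h => Subtype.ext ?_⟩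
  · rw [OptSys.operatorGraph_optOp]
    exact OptSys.isMaximallyMonotone_blockGraph (OptSys.dense_H1 hT n)
      (OptSys.isClosed_graph_stateOp hT A) hL hmono
  · have hg := OptSys.operatorGraph_optOp hT A B α F xref uref x₀
    exact OptSys.blockGraph_injective (OptSys.dense_H1 hT n)
      (OptSys.eq_zero_of_inner_stateOp hT A) hmono (hg.subset ⟨w, rfl⟩)
      (hg.subset ⟨w', by rw [h]⟩)
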